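/- Let $k$ be an infinite field and let $A=k[x_1,x_2,x_3,x_4]/I$ be a standard graded artinian Gorenstein $k$-algebra, i.e. $I$ is a homogeneous ideal, $\dim_k A<\infty$, and the socle $\{a\in A : x_1a=x_2a=x_3a=x_4a=0\}$ of $A$ has dimension $1$ over $k$. Let $h_d=\dim_k A_d$ be its Hilbert function, let $e=\max\{d : A_d\ne 0\}$ be its socle degree, and assume that $A$ has codimension $4$, i.e. $h_1=4$. (Thus $(1,4,h_2,\dots,h_e)$ is a Gorenstein $h$-vector of codimension $4$ and socle degree $e$.) If $i\ge 0$ is an integer such that $$e>\frac{i^2+12i+2}{6},$$ then the $h$-vector is unimodal up to degree $i+1$, that is, $h_0\le h_1\le\cdots\le h_i\le h_{i+1}$. -/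

import Mathlib

open MvPolynomial

attribute [local instance] MvPolynomial.gradedAlgebra

/-- The Hilbert function of `A = k[x_1, …, x_r] / I`: its value at `d` is `dim_k A_d`, where `A_d` is
the image in `A` of the space of forms of degree `d`. -/
noncomputable def hilbertFunction {k : Type*} [Field k] {r : ℕ} (I : Ideal (MvPolynomial (Fin r) k))
    (d : ℕ) : ℕ :=
  Module.finrank k
    ((homogeneousSubmodule (Fin r) k d).map (Ideal.Quotient.mkₐ k I).toLinearMap)

/-- The socle `(0 : 𝔪)` of `A = k[x_1, …, x_r] / I`, where `𝔪` is the ideal generated by the classes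
of the variables. -/
def socle {k : Type*} [Field k] {r : ℕ} (I : Ideal (MvPolynomial (Fin r) k)) :
    Ideal (MvPolynomial (Fin r) k ⧸ I) where
  carrier := {a | ∀ j : Fin r, Ideal.Quotient.mk I (X j) * a = 0}
  zero_mem' := fun j => mul_zero _
  add_mem' := by
    intro a b ha hb j
    rw [mul_add, ha j, hb j, add_zero]
  smul_mem' := by
    intro c a ha j
    rw [smul_eq_mul, mul_left_comm, ha j, mul_zero]

/-- `k[x_1, …, x_r] / I` is a standard graded artinian Gorenstein `k`-algebra: `I` is homogeneous,
the quotient is artinian, and its socle has dimension one over `k`. -/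
structure IsArtinianGorenstein {k : Type*} [Field k] {r : ℕ}
    (I : Ideal (MvPolynomial (Fin r) k)) : Prop where
  homogeneous : I.IsHomogeneous (homogeneousSubmodule (Fin r) k)
  artinian : IsArtinianRing (MvPolynomial (Fin r) k ⧸ I)
  finrank_socle : Module.finrank k (socle I) = 1

/-- `h = (h_0, h_1, …, h_e)`, extended by zero beyond degree `e`, is a Gorenstein `h`-vector of
codimension `r` and socle degree `e` over `k`: it is the Hilbert function of an artinian Gorenstein
algebra `k[x_1, …, x_r] / I` with `h_1 = r` (so `I` contains no nonzero linear form), and `e` is the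
largest degree in which this algebra is nonzero. -/
def IsGorensteinHVector (k : Type*) [Field k] (r e : ℕ) (h : ℕ → ℕ) : Prop :=
  ∃ I : Ideal (MvPolynomial (Fin r) k), IsArtinianGorenstein I ∧
    (∀ d, h d = hilbertFunction I d) ∧ h 1 = r ∧ IsGreatest {d | h d ≠ 0} e

/-- `h` is unimodal up to degree `d`: it does not decrease in degrees `0, 1, …, d`, so
`h_0 ≤ h_1 ≤ ⋯ ≤ h_d`. -/
def UnimodalUpTo (h : ℕ → ℕ) (d : ℕ) : Prop :=
  ∀ j, j < d → h j ≤ h (j + 1)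

/-! Let j = e - i - 1 and let r(d) be the dimension in degree d of A/(L), for a linear form L
minimizing r(j + 1). Multiplication by L gives h_{d+1} = dim (S/(I : L))_d + r(d + 1), with S the
polynomial ring. By duality S/(I : L) has equal dimensions in degrees i and j, and h_{j+1} = h_i;
hence h_{i+1} - h_i = r(i + 1) - r(j + 1) (`hilbertFunction_add_restrictionRank`).

Suppose r(i + 1) < r(j + 1). If r(i + 1) ≤ i + 1, then r cannot grow from degree i + 1 on
(`quotRank_succ_le_of_le`), a contradiction. So r(j + 1) ≥ i + 3, and the Green-type bound
`restrictionRank_add_staircase_le` makes h_{j+1} = h_i larger than the number of monomials of degree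
i in four variables, precisely because 6e > i² + 12i + 2. -/

/-! ### Ranks modulo a subspace, and genericity along lines. -/

section LinearAlgebra

variable {k M N : Type*} [Field k] [AddCommGroup M] [Module k M] [AddCommGroup N] [Module k N]

/-- The dimension of the image of `V` modulo `K`, that is, of `V / (V ∩ K)`. -/
noncomputable def quotRank (V K : Submodule k M) : ℕ :=
  Module.finrank k (V.map K.mkQ)

theorem finrank_map_congr {N' : Type*} [AddCommGroup N'] [Module k N'] (V : Submodule k M)
    (f : M →ₗ[k] N) (g : M →ₗ[k] N') (h : ∀ x ∈ V, f x = 0 ↔ g x = 0) :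
    Module.finrank k (V.map f) = Module.finrank k (V.map g) := by
  rw [← LinearMap.range_domRestrict, ← LinearMap.range_domRestrict,
    ← (f.domRestrict V).quotKerEquivRange.finrank_eq,
    ← (g.domRestrict V).quotKerEquivRange.finrank_eq]
  have : LinearMap.ker (f.domRestrict V) = LinearMap.ker (g.domRestrict V) := by
    ext ⟨x, hx⟩
    simpa using h x hx
  rw [this]

theorem finrank_map_eq_quotRank (V K : Submodule k M) (f : M →ₗ[k] N)
    (h : ∀ x ∈ V, f x = 0 ↔ x ∈ K) : Module.finrank k (V.map f) = quotRank V K :=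
  finrank_map_congr V f K.mkQ fun x hx => by simpa using h x hx

theorem quotRank_anti (V : Submodule k M) [FiniteDimensional k V] {K K' : Submodule k M}
    (h : K ≤ K') : quotRank V K' ≤ quotRank V K := by
  have : V.map K'.mkQ = (V.map K.mkQ).map (Submodule.factor h) := by
    rw [← Submodule.map_comp, Submodule.factor_comp_mk]
  unfold quotRank
  rw [this]
  exact Submodule.finrank_map_le _ _

theorem quotRank_le_finrank (V K : Submodule k M) [FiniteDimensional k V] :
    quotRank V K ≤ Module.finrank k V :=
  Submodule.finrank_map_le _ _

theorem quotRank_eq_zero_iff {V K : Submodule k M} [FiniteDimensional k V] :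
    quotRank V K = 0 ↔ V ≤ K := by
  unfold quotRank
  rw [Submodule.finrank_eq_zero, ← le_bot_iff, Submodule.map_le_iff_le_comap, Submodule.comap_bot,
    Submodule.ker_mkQ]

theorem finrank_eq_add_quotRank {X Y : Submodule k M} [FiniteDimensional k X] (h : Y ≤ X) :
    Module.finrank k X = Module.finrank k Y + quotRank X Y := by
  have h1 := LinearMap.finrank_range_add_finrank_ker (Y.mkQ.domRestrict X)
  rw [LinearMap.range_domRestrict] at h1
  have h2 : LinearMap.ker (Y.mkQ.domRestrict X) = Y.submoduleOf X := by
    ext x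
    simp [Submodule.submoduleOf]
  rw [h2, (Submodule.submoduleOfEquivOfLe h).finrank_eq] at h1
  rw [← h1, add_comm, quotRank]

theorem quotRank_eq_add {U V : Submodule k M} [FiniteDimensional k V] (K : Submodule k M)
    (h : U ≤ V) : quotRank V K = quotRank U K + quotRank V (K ⊔ U) := by
  have h1 := finrank_eq_add_quotRank (Submodule.map_mono (f := K.mkQ) h)
  have h2 : quotRank (V.map K.mkQ) (U.map K.mkQ) = quotRank V (K ⊔ U) := by
    rw [quotRank, ← Submodule.map_comp]
    refine finrank_map_eq_quotRank _ _ _ fun x _ => ?_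
    rw [← Submodule.comap_map_mkQ]
    simp only [LinearMap.comp_apply, Submodule.mkQ_apply, Submodule.Quotient.mk_eq_zero,
      Submodule.mem_comap]
  rw [← h2]
  exact h1

theorem quotRank_map (V : Submodule k M) (f : M →ₗ[k] N) (K : Submodule k N) :
    quotRank (V.map f) K = quotRank V (K.comap f) := by
  rw [quotRank, ← Submodule.map_comp]
  exact finrank_map_eq_quotRank _ _ _ fun x _ => by simp

/-- The rank is lower semicontinuous along a line of linear maps. -/
theorem finite_finrank_range_add_smul_lt [FiniteDimensional k M] (f g : M →ₗ[k] N) :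
    {t : k | Module.finrank k (LinearMap.range (f + t • g)) <
      Module.finrank k (LinearMap.range f)}.Finite := by
  obtain ⟨C, hC⟩ := Submodule.exists_isCompl (LinearMap.ker f)
  have hker : LinearMap.ker (f.domRestrict C) = ⊥ := by
    rw [LinearMap.ker_eq_bot']
    rintro ⟨x, hx⟩ h0
    have : x ∈ LinearMap.ker f ⊓ C := ⟨by simpa using h0, hx⟩
    rw [hC.inf_eq_bot, Submodule.mem_bot] at this
    simpa using this
  obtain ⟨ρ, hρ⟩ := LinearMap.exists_leftInverse_of_injective _ hker
  -- On the complement `C`, `f + t • g` can fail to be injective only if -1/t is one of the finitely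
  -- many eigenvalues of `ρ ∘ g`.
  have hfin := Module.End.finite_hasEigenvalue (ρ ∘ₗ g.domRestrict C)
  refine (hfin.image fun μ => -μ⁻¹).subset fun t ht => ?_
  by_contra hne
  rw [Set.mem_ofPred_eq, ← not_le] at ht
  refine ht ?_
  have hinj : Function.Injective ((f + t • g).domRestrict C) := by
    rw [← LinearMap.ker_eq_bot, LinearMap.ker_eq_bot']
    intro x hx
    by_contra hx0
    have h1 : x + t • (ρ ∘ₗ g.domRestrict C) x = 0 := by
      have := congrArg ρ hx
      have h2 := LinearMap.congr_fun hρ x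
      simp only [LinearMap.comp_apply, LinearMap.domRestrict_apply, LinearMap.id_apply] at h2
      simpa [h2] using this
    have ht0 : t ≠ 0 := by
      rintro rfl
      simp [hx0] at h1
    refine hne ⟨-t⁻¹, ?_, by simp⟩
    refine Module.End.hasEigenvalue_of_hasEigenvector (x := x) ⟨?_, hx0⟩
    rw [Module.End.mem_eigenspace_iff]
    have h3 : t • (ρ ∘ₗ g.domRestrict C) x = -x := (neg_eq_of_add_eq_zero_right h1).symm
    rw [neg_smul, ← smul_neg, ← h3, smul_smul, inv_mul_cancel₀ ht0, one_smul]
  have h1 : Module.finrank k C = Module.finrank k (LinearMap.range f) := by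
    have h2 := Submodule.finrank_add_eq_of_isCompl hC
    have h3 := f.finrank_range_add_finrank_ker
    omega
  rw [← h1, ← LinearMap.finrank_range_of_inj hinj, LinearMap.range_domRestrict]
  exact Submodule.finrank_mono LinearMap.map_le_range

/-- The left and right kernels of a pairing have the same codimension. -/
theorem finrank_quotient_ker_flip [FiniteDimensional k M] [FiniteDimensional k N]
    (B : M →ₗ[k] N →ₗ[k] k) :
    Module.finrank k (M ⧸ LinearMap.ker B) = Module.finrank k (N ⧸ LinearMap.ker B.flip) := by
  rw [B.quotKerEquivRange.finrank_eq, B.flip.quotKerEquivRange.finrank_eq,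
    ← LinearMap.finrank_range_dualMap_eq_finrank_range]
  have : B.flip = B.dualMap ∘ₗ (Module.evalEquiv k N).toLinearMap := by
    ext x y
    simp
  rw [this, LinearMap.range_comp_of_range_eq_top _ (LinearEquiv.range _)]

/-- A property of vectors that, if it holds at a vector, holds at almost all points of each line
through that vector. -/
def LineOpen (P : M → Prop) : Prop :=
  ∀ (w v : M), P w → {t : k | ¬ P (w + t • v)}.Finite

theorem LineOpen.and {P Q : M → Prop} (hP : LineOpen (k := k) P) (hQ : LineOpen (k := k) Q) :
    LineOpen (k := k) fun w => P w ∧ Q w := by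
  intro w v h
  refine ((hP w v h.1).union (hQ w v h.2)).subset fun t ht => ?_
  simp only [Set.mem_ofPred_eq, not_and_or] at ht
  exact ht

/-- On the line joining the two witnesses each property fails at finitely many points only. This
replaces the intersection of nonempty Zariski-open sets. -/
theorem LineOpen.exists_and [Infinite k] {P Q : M → Prop} (hP : LineOpen (k := k) P)
    (hQ : LineOpen (k := k) Q) (h1 : ∃ w, P w) (h2 : ∃ w, Q w) : ∃ w, P w ∧ Q w := by
  obtain ⟨w₁, h1⟩ := h1
  obtain ⟨w₂, h2⟩ := h2
  have f1 := hP w₁ (w₂ - w₁) h1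
  have f2 := (hQ w₂ (w₁ - w₂) h2).image fun s => 1 - s
  obtain ⟨t, ht⟩ := (f1.union f2).infinite_compl.nonempty
  simp only [Set.mem_compl_iff, Set.mem_union, not_or] at ht
  refine ⟨w₁ + t • (w₂ - w₁), by simpa using ht.1, ?_⟩
  by_contra hc
  refine ht.2 ⟨1 - t, ?_, by simp⟩
  have : w₂ + (1 - t) • (w₁ - w₂) = w₁ + t • (w₂ - w₁) := by module
  rwa [Set.mem_ofPred_eq, this]

end LinearAlgebra

/-! ### Restriction to a hyperplane: weak Green and Macaulay bounds. -/

section Restriction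

variable {σ k : Type*} [Field k]

instance finiteDimensional_homogeneousSubmodule [Finite σ] (d : ℕ) :
    FiniteDimensional k (homogeneousSubmodule σ k d) :=
  Module.Finite.iff_fg.mpr (homogeneousSubmodule_fg σ k d)

/-- The multiples of `L` by a form of degree `d - 1`. -/
noncomputable def formMultiples (L : MvPolynomial σ k) : ℕ → Submodule k (MvPolynomial σ k)
  | 0 => ⊥
  | d + 1 => (homogeneousSubmodule σ k d).map (LinearMap.mulLeft k L)

/-- The dimension in degree `d` of the restriction modulo `L` of the quotient by `K`. -/
noncomputable def restrictionRank (K : Submodule k (MvPolynomial σ k)) (L : MvPolynomial σ k)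
    (d : ℕ) : ℕ :=
  quotRank (homogeneousSubmodule σ k d) (K ⊔ formMultiples L d)

theorem formMultiples_le {L : MvPolynomial σ k} (hL : L ∈ homogeneousSubmodule σ k 1) (d : ℕ) :
    formMultiples L d ≤ homogeneousSubmodule σ k d := by
  cases d with
  | zero => exact bot_le
  | succ d =>
    rintro _ ⟨f, hf, rfl⟩
    rw [add_comm]
    exact IsHomogeneous.mul hL hf

theorem mul_mem_formMultiples {L x f : MvPolynomial σ k} (hx : x ∈ homogeneousSubmodule σ k 1)
    {d : ℕ} (hf : f ∈ formMultiples L d) : x * f ∈ formMultiples L (d + 1) := by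
  cases d with
  | zero =>
    rw [formMultiples, Submodule.mem_bot] at hf
    rw [hf, mul_zero]
    exact zero_mem _
  | succ d =>
    obtain ⟨g, hg, rfl⟩ := hf
    refine ⟨x * g, ?_, by simp [mul_left_comm]⟩
    rw [add_comm]
    exact IsHomogeneous.mul hx hg

theorem homogeneousSubmodule_succ_le {d : ℕ} {K : Submodule k (MvPolynomial σ k)}
    (h : ∀ L ∈ homogeneousSubmodule σ k 1, ∀ f ∈ homogeneousSubmodule σ k d, L * f ∈ K) :
    homogeneousSubmodule σ k (d + 1) ≤ K := by
  rw [← homogeneousSubmodule_one_pow, pow_succ', homogeneousSubmodule_one_pow, Submodule.mul_le]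
  exact h

theorem quotRank_succ_eq_add [Finite σ] (K : Submodule k (MvPolynomial σ k))
    {L : MvPolynomial σ k} (hL : L ∈ homogeneousSubmodule σ k 1) (d : ℕ) :
    quotRank (homogeneousSubmodule σ k (d + 1)) K =
      quotRank (homogeneousSubmodule σ k d) (K.comap (LinearMap.mulLeft k L)) +
        restrictionRank K L (d + 1) := by
  rw [quotRank_eq_add K (formMultiples_le hL (d + 1)), formMultiples, quotRank_map]
  rfl

theorem restrictionRank_le [Finite σ] (K : Submodule k (MvPolynomial σ k))
    (L : MvPolynomial σ k) (d : ℕ) :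
    restrictionRank K L d ≤ quotRank (homogeneousSubmodule σ k d) K :=
  quotRank_anti _ le_sup_left

/-- The restriction rank and the rank of multiplication by `L` have a sum independent of `L`, and
the latter is lower semicontinuous. -/
theorem lineOpen_restrictionRank_le [Finite σ] (K : Submodule k (MvPolynomial σ k)) (d m : ℕ) :
    LineOpen (k := k) fun L : homogeneousSubmodule σ k 1 =>
      restrictionRank K (L : MvPolynomial σ k) d ≤ m := by
  intro L L' h
  cases d with
  | zero =>
    convert Set.finite_empty
    ext t
    simpa [restrictionRank, formMultiples] using h
  | succ d =>
    let φ (L : MvPolynomial σ k) : homogeneousSubmodule σ k d →ₗ[k] MvPolynomial σ k ⧸ K :=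
      (K.mkQ ∘ₗ LinearMap.mulLeft k L).domRestrict _
    have hφ (L : homogeneousSubmodule σ k 1) :
        quotRank (homogeneousSubmodule σ k (d + 1)) K =
          Module.finrank k (LinearMap.range (φ L)) + restrictionRank K (L : MvPolynomial σ k)
            (d + 1) := by
      rw [quotRank_succ_eq_add K L.2, LinearMap.range_domRestrict]
      congr 1
      exact (finrank_map_eq_quotRank _ _ _ fun x _ => by simp).symm
    refine (finite_finrank_range_add_smul_lt (φ L) (φ L')).subset fun t ht => ?_
    have h1 : φ (L + t • L' : homogeneousSubmodule σ k 1) = φ L + t • φ L' := by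
      ext x
      simp [φ, add_mul]
    have h2 := hφ L
    have h3 := hφ (L + t • L')
    rw [h1] at h3
    simp only [Set.mem_ofPred_eq] at ht ⊢
    omega

theorem exists_restrictionRank_minimal (K : Submodule k (MvPolynomial σ k)) (d : ℕ) :
    ∃ L : homogeneousSubmodule σ k 1, ∀ L' : homogeneousSubmodule σ k 1,
      restrictionRank K (L : MvPolynomial σ k) d ≤ restrictionRank K (L' : MvPolynomial σ k) d := by
  let f (L : homogeneousSubmodule σ k 1) : ℕ := restrictionRank K (L : MvPolynomial σ k) d
  exact ⟨Function.argmin f, fun L' => Function.argmin_le f L'⟩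

/-- The sum `d + (d - 1) + ⋯` of `s` terms, truncated at zero. -/
def staircase (d s : ℕ) : ℕ := ∑ t ∈ Finset.range s, (d - t)

theorem staircase_mono (d : ℕ) : Monotone (staircase d) := fun _ _ h =>
  Finset.sum_le_sum_of_subset (Finset.range_mono h)

theorem staircase_le_add (d s : ℕ) : staircase (d + 1) s ≤ s + staircase d s := by
  calc staircase (d + 1) s ≤ ∑ t ∈ Finset.range s, (1 + (d - t)) :=
        Finset.sum_le_sum fun t _ => by omega
    _ = s + staircase d s := by simp [staircase, Finset.sum_add_distrib]

theorem le_staircase (d : ℕ) {s : ℕ} (hs : 1 ≤ s) : d ≤ staircase d s :=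
  le_trans (by simp [staircase]) (staircase_mono d hs)

/-- The terms `d - t` vanish once `t ≥ d`. -/
theorem staircase_le_of_le (d : ℕ) {s : ℕ} (hs : d ≤ s) (s' : ℕ) :
    staircase d s' ≤ staircase d s := by
  rcases le_total s' s with h | h
  · exact staircase_mono d h
  · refine (Finset.sum_subset (Finset.range_mono h) fun t _ ht => ?_).ge
    simp only [Finset.mem_range, not_lt] at ht
    omega

/-- A weak form of Green's hyperplane restriction theorem. -/
theorem restrictionRank_add_staircase_le [Finite σ] [Infinite k] (d : ℕ) :
    ∀ (K : Submodule k (MvPolynomial σ k)) (L : homogeneousSubmodule σ k 1),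
      (∀ L' : homogeneousSubmodule σ k 1,
        restrictionRank K (L : MvPolynomial σ k) d ≤ restrictionRank K (L' : MvPolynomial σ k) d) →
      restrictionRank K (L : MvPolynomial σ k) d +
        staircase d (restrictionRank K (L : MvPolynomial σ k) d) ≤
          quotRank (homogeneousSubmodule σ k d) K := by
  induction d with
  | zero =>
    intro K L _
    simpa [staircase] using restrictionRank_le K L 0
  | succ d ihd =>
    intro K
    induction hn : quotRank (homogeneousSubmodule σ k (d + 1)) K using Nat.strong_induction_on
      generalizing K with
    | _ n ihn =>
    subst hn
    intro L₀ hL₀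
    set c := restrictionRank K (L₀ : MvPolynomial σ k) (d + 1) with hc
    rcases (restrictionRank_le K L₀ (d + 1)).lt_or_eq with hlt | heq
    swap
    -- If even the minimal restriction loses nothing, every linear form multiplies degree `d` into
    -- `K`, so both ranks are zero.
    · have hall : ∀ L ∈ homogeneousSubmodule σ k 1, ∀ f ∈ homogeneousSubmodule σ k d,
          L * f ∈ K := by
        intro L hL
        have h1 := quotRank_succ_eq_add K hL d
        have h2 := hL₀ ⟨L, hL⟩
        have h3 : quotRank (homogeneousSubmodule σ k d) (K.comap (LinearMap.mulLeft k L)) = 0 := by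
          simp only at h2
          omega
        exact fun f hf => quotRank_eq_zero_iff.mp h3 hf
      have h0 := quotRank_eq_zero_iff.mpr (homogeneousSubmodule_succ_le hall)
      have hc0 : c = 0 := by omega
      simp [hc0, staircase]
    -- the restriction of `K` modulo two linear forms
    let r (L L' : homogeneousSubmodule σ k 1) : ℕ :=
      restrictionRank (K ⊔ formMultiples (L' : MvPolynomial σ k) (d + 1)) (L : MvPolynomial σ k)
        (d + 1)
    have hsymm (L L' : homogeneousSubmodule σ k 1) : r L L' = r L' L := by
      simp only [r, restrictionRank, sup_right_comm]
    -- A minimizing pair makes it possible to choose `L`, `L'` each attaining `c`, with `L` minimal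
    -- modulo `L'` and `L'` minimal for the colon `K : L`.
    obtain ⟨⟨M, M'⟩, hM⟩ : ∃ p : homogeneousSubmodule σ k 1 × homogeneousSubmodule σ k 1,
        ∀ L L', r p.1 p.2 ≤ r L L' :=
      ⟨Function.argmin fun p => r p.1 p.2, fun L L' =>
        Function.argmin_le (fun p : homogeneousSubmodule σ k 1 × homogeneousSubmodule σ k 1 =>
          r p.1 p.2) (L, L')⟩
    simp only at hM
    obtain ⟨L, hLc, hLr⟩ := (lineOpen_restrictionRank_le K (d + 1) c).exists_and
      (lineOpen_restrictionRank_le (K ⊔ formMultiples (M' : MvPolynomial σ k) (d + 1)) (d + 1)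
        (r M M')) ⟨L₀, le_rfl⟩ ⟨M, le_rfl⟩
    obtain ⟨N, hN⟩ := exists_restrictionRank_minimal
      (K.comap (LinearMap.mulLeft k (L : MvPolynomial σ k))) d
    obtain ⟨L', ⟨hLc', hLr'⟩, hLN⟩ := ((lineOpen_restrictionRank_le K (d + 1) c).and
      (lineOpen_restrictionRank_le (K ⊔ formMultiples (L : MvPolynomial σ k) (d + 1)) (d + 1)
        (r M M'))).exists_and
      (lineOpen_restrictionRank_le (K.comap (LinearMap.mulLeft k (L : MvPolynomial σ k))) d _)
      ((lineOpen_restrictionRank_le K (d + 1) c).exists_and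
      (lineOpen_restrictionRank_le (K ⊔ formMultiples (L : MvPolynomial σ k) (d + 1)) (d + 1)
        (r M M')) ⟨L₀, le_rfl⟩ ⟨M', (hsymm M' L).trans_le hLr⟩) ⟨N, le_rfl⟩
    have hLceq := le_antisymm hLc (hL₀ L)
    have hLceq' := le_antisymm hLc' (hL₀ L')
    have hmin : ∀ L'', r L L' ≤ r L'' L' := fun L'' =>
      ((hsymm L L').trans_le hLr').trans (hM L'' L')
    set K₂ := K ⊔ formMultiples (L' : MvPolynomial σ k) (d + 1) with hK₂
    have hK₂c : quotRank (homogeneousSubmodule σ k (d + 1)) K₂ = c := hLceq'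
    have ih₂ := ihn _ (hK₂c.trans_lt hlt) K₂ rfl L hmin
    rw [hK₂c] at ih₂
    set c' := restrictionRank K₂ (L : MvPolynomial σ k) (d + 1) with hc'
    have ih₁ := ihd (K.comap (LinearMap.mulLeft k (L : MvPolynomial σ k))) L'
      fun L'' => hLN.trans (hN L'')
    set c'' := restrictionRank (K.comap (LinearMap.mulLeft k (L : MvPolynomial σ k)))
      (L' : MvPolynomial σ k) d with hc''
    -- Modulo `L'`, multiplication by `L` has kernel containing both `K : L` and the multiples of
    -- `L'`.
    have hsub : c ≤ c'' + c' := by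
      rw [← hK₂c, quotRank_succ_eq_add K₂ L.2]
      refine Nat.add_le_add_right (quotRank_anti _ (sup_le ?_ ?_)) _
      · exact Submodule.comap_mono le_sup_left
      · intro f hf
        exact Submodule.mem_sup_right (mul_mem_formMultiples L.2 hf)
    have htot := quotRank_succ_eq_add K L.2 d
    rw [hLceq] at htot
    -- If `c' > 0`, then `ih₂` forces `c - c' ≥ d + 1`, so `c'' ≥ d + 1` and the staircase is
    -- already saturated at `c''`.
    have hstep : staircase (d + 1) c ≤ staircase (d + 1) c'' := by
      rcases Nat.eq_zero_or_pos c' with h0 | h0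
      · exact staircase_mono _ (by omega)
      · have := le_staircase (d + 1) h0
        exact staircase_le_of_le _ (by omega) _
    have := staircase_le_add d c''
    omega

/-- A weak form of Macaulay's theorem: if the Hilbert function is at most `m` in degree `m`, then
it does not increase from degree `m` to degree `m + 1`. -/
theorem quotRank_succ_le_of_le [Finite σ] [Infinite k] {m : ℕ}
    {K K' : Submodule k (MvPolynomial σ k)}
    (hKK' : ∀ x ∈ homogeneousSubmodule σ k 1, ∀ f ∈ K, x * f ∈ K')
    (hm : quotRank (homogeneousSubmodule σ k m) K ≤ m) :
    quotRank (homogeneousSubmodule σ k (m + 1)) K' ≤ quotRank (homogeneousSubmodule σ k m) K := by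
  obtain ⟨L, hL⟩ := exists_restrictionRank_minimal K m
  have h1 := restrictionRank_add_staircase_le m K L hL
  -- A nonzero restriction rank would force a total of at least `m + 1`.
  have h0 : restrictionRank K (L : MvPolynomial σ k) m = 0 := by
    by_contra hne
    have := le_staircase m (Nat.one_le_iff_ne_zero.mpr hne)
    omega
  have h2 : homogeneousSubmodule σ k m ≤ K ⊔ formMultiples (L : MvPolynomial σ k) m :=
    quotRank_eq_zero_iff.mp h0
  have h3 : restrictionRank K' (L : MvPolynomial σ k) (m + 1) = 0 := by
    refine quotRank_eq_zero_iff.mpr (homogeneousSubmodule_succ_le fun x hx f hf => ?_)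
    obtain ⟨a, ha, b, hb, rfl⟩ := Submodule.mem_sup.mp (h2 hf)
    rw [mul_add]
    exact Submodule.add_mem_sup (hKK' x hx a ha) (mul_mem_formMultiples hx hb)
  rw [quotRank_succ_eq_add K' L.2, h3, add_zero]
  exact quotRank_anti _ fun f hf => hKK' _ L.2 f hf

end Restriction

theorem finrank_quotient_eq_quotRank {k M : Type*} [Field k] [AddCommGroup M] [Module k M]
    {V K : Submodule k M} {N : Submodule k V} (h : ∀ x : V, x ∈ N ↔ (x : M) ∈ K) :
    Module.finrank k (V ⧸ N) = quotRank V K := by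
  have hN : N = LinearMap.ker (K.mkQ.domRestrict V) := by
    ext x
    simp [h x]
  rw [hN, (K.mkQ.domRestrict V).quotKerEquivRange.finrank_eq, LinearMap.range_domRestrict, quotRank]

theorem finrank_homogeneousSubmodule (k : Type*) [Field k] (n d : ℕ) :
    Module.finrank k (homogeneousSubmodule (Fin n) k d) = (n + d - 1).choose d := by
  let s : Finset (Fin n →₀ ℕ) := Finset.univ.finsuppAntidiag d
  have h : {f : Fin n →₀ ℕ | f.degree = d} = (s : Set (Fin n →₀ ℕ)) := by
    ext f
    simp [s, Finset.mem_finsuppAntidiag, Finsupp.degree_eq_sum]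
  rw [homogeneousSubmodule_eq_finsupp_supported, h]
  have hb := Module.finrank_eq_nat_card_basis (basisRestrictSupport k (s : Set (Fin n →₀ ℕ)))
  rw [restrictSupport] at hb
  rw [hb, Nat.card_coe_set_eq, Set.ncard_coe_finset, Finset.card_finsuppAntidiag_nat_eq_choose]
  simp

/-! ### Gorenstein duality. -/

section Duality

variable {k : Type*} [Field k] {n : ℕ} {I : Ideal (MvPolynomial (Fin n) k)}

theorem hilbertFunction_eq_quotRank (I : Ideal (MvPolynomial (Fin n) k)) (d : ℕ) :
    hilbertFunction I d = quotRank (homogeneousSubmodule (Fin n) k d) (I.restrictScalars k) :=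
  finrank_map_eq_quotRank _ _ _ fun x _ => by
    simp [Ideal.Quotient.eq_zero_iff_mem]

theorem homogeneousSubmodule_le_of_isGreatest {e : ℕ}
    (he : IsGreatest {d | hilbertFunction I d ≠ 0} e) {d : ℕ} (hd : e < d) :
    homogeneousSubmodule (Fin n) k d ≤ I.restrictScalars k := by
  rw [← quotRank_eq_zero_iff, ← hilbertFunction_eq_quotRank]
  by_contra h
  exact absurd (he.2 h) (not_le.mpr hd)

theorem mk_mem_socle_of_isGreatest {e : ℕ} (he : IsGreatest {d | hilbertFunction I d ≠ 0} e)
    {f : MvPolynomial (Fin n) k} (hf : f ∈ homogeneousSubmodule (Fin n) k e) :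
    Ideal.Quotient.mk I f ∈ socle I := by
  intro j
  rw [← map_mul, Ideal.Quotient.eq_zero_iff_mem]
  refine homogeneousSubmodule_le_of_isGreatest he (lt_one_add e) ?_
  exact (isHomogeneous_X k j).mul hf

theorem socle_eq_map_of_isGreatest (hG : IsArtinianGorenstein I) {e : ℕ}
    (he : IsGreatest {d | hilbertFunction I d ≠ 0} e) :
    (homogeneousSubmodule (Fin n) k e).map (Ideal.Quotient.mkₐ k I).toLinearMap =
      (socle I).restrictScalars k := by
  have h1 : Module.finrank k ((socle I).restrictScalars k) = 1 := hG.finrank_socle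
  have : FiniteDimensional k ((socle I).restrictScalars k) :=
    Module.finite_of_finrank_eq_succ h1
  have hle : (homogeneousSubmodule (Fin n) k e).map (Ideal.Quotient.mkₐ k I).toLinearMap ≤
      (socle I).restrictScalars k := by
    rintro _ ⟨f, hf, rfl⟩
    exact mk_mem_socle_of_isGreatest he hf
  refine Submodule.eq_of_le_of_finrank_le hle ?_
  rw [h1]
  exact Nat.one_le_iff_ne_zero.mpr he.1

theorem exists_functional_of_isGreatest (hG : IsArtinianGorenstein I) {e : ℕ}
    (he : IsGreatest {d | hilbertFunction I d ≠ 0} e) :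
    ∃ φ : MvPolynomial (Fin n) k →ₗ[k] k,
      ∀ f ∈ homogeneousSubmodule (Fin n) k e, φ f = 0 ↔ f ∈ I := by
  have h1 : Module.finrank k ((socle I).restrictScalars k) = 1 := hG.finrank_socle
  have : FiniteDimensional k ((socle I).restrictScalars k) :=
    Module.finite_of_finrank_eq_succ h1
  let ψ : (socle I).restrictScalars k ≃ₗ[k] k :=
    LinearEquiv.ofFinrankEq _ _ (h1.trans (Module.finrank_self k).symm)
  obtain ⟨Ψ, hΨ⟩ := LinearMap.exists_extend ψ.toLinearMap
  refine ⟨Ψ ∘ₗ (Ideal.Quotient.mkₐ k I).toLinearMap, fun f hf => ?_⟩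
  have h2 := LinearMap.congr_fun hΨ ⟨_, mk_mem_socle_of_isGreatest he hf⟩
  simp only [LinearMap.comp_apply, Submodule.subtype_apply, LinearEquiv.coe_coe] at h2
  simp only [LinearMap.comp_apply, AlgHom.toLinearMap_apply, Ideal.Quotient.mkₐ_eq_mk]
  rw [h2, LinearEquiv.map_eq_zero_iff, ← Ideal.Quotient.eq_zero_iff_mem]
  exact Subtype.ext_iff

/-- The socle lives in degree `e` alone, so below that degree some variable keeps a nonzero class
nonzero; repeat `j` times. -/
theorem exists_mul_notMem (hG : IsArtinianGorenstein I) {e : ℕ}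
    (he : IsGreatest {d | hilbertFunction I d ≠ 0} e) (j : ℕ) :
    ∀ {d : ℕ}, d + j = e → ∀ f ∈ homogeneousSubmodule (Fin n) k d, f ∉ I →
      ∃ g ∈ homogeneousSubmodule (Fin n) k j, f * g ∉ I := by
  induction j with
  | zero =>
    intro d _ f _ hfI
    exact ⟨1, isHomogeneous_one _ _, by rwa [mul_one]⟩
  | succ j ih =>
    intro d hd f hf hfI
    have hsoc : Ideal.Quotient.mk I f ∉ socle I := by
      intro hmem
      have h1 : Ideal.Quotient.mk I f ∈ (socle I).restrictScalars k := hmem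
      rw [← socle_eq_map_of_isGreatest hG he] at h1
      obtain ⟨g, hg, hgf⟩ := h1
      have h2 : g - f ∈ I := Ideal.Quotient.eq.mp hgf
      have h3 := (mem_iff_homogeneousComponent_mem hG.homogeneous _).mp h2 d
      rw [map_sub, homogeneousComponent_of_mem hf, homogeneousComponent_of_mem hg,
        if_pos rfl, if_neg (by omega), zero_sub, neg_mem_iff] at h3
      exact hfI h3
    have : ∃ l : Fin n, X l * f ∉ I := by
      by_contra! hall
      refine hsoc fun l => ?_
      rw [← map_mul, Ideal.Quotient.eq_zero_iff_mem]
      exact hall l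
    obtain ⟨l, hl⟩ := this
    obtain ⟨g, hg, hgI⟩ := ih (d := 1 + d) (by omega) (X l * f) ((isHomogeneous_X k l).mul hf) hl
    refine ⟨g * X l, hg.mul (isHomogeneous_X k l), ?_⟩
    rwa [show f * (g * X l) = X l * f * g by ring]

/-- Gorenstein duality for the quotient by the colon ideal `I : p` of a form `p`. -/
theorem quotRank_comap_mulLeft_symm (hG : IsArtinianGorenstein I) {e : ℕ}
    (he : IsGreatest {d | hilbertFunction I d ≠ 0} e) {a i j : ℕ} (hij : a + i + j = e)
    {p : MvPolynomial (Fin n) k} (hp : p ∈ homogeneousSubmodule (Fin n) k a) :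
    quotRank (homogeneousSubmodule (Fin n) k i)
        ((I.restrictScalars k).comap (LinearMap.mulLeft k p)) =
      quotRank (homogeneousSubmodule (Fin n) k j)
        ((I.restrictScalars k).comap (LinearMap.mulLeft k p)) := by
  obtain ⟨φ, hφ⟩ := exists_functional_of_isGreatest hG he
  have key : ∀ {i j : ℕ}, a + i + j = e → ∀ f ∈ homogeneousSubmodule (Fin n) k i,
      (∀ g ∈ homogeneousSubmodule (Fin n) k j, φ (p * (f * g)) = 0) ↔ p * f ∈ I := by
    intro i j hij f hf
    have hpf := hp.mul hf
    constructor
    · intro h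
      by_contra hne
      obtain ⟨g, hg, hgI⟩ := exists_mul_notMem hG he j hij _ hpf hne
      have hpfg : p * f * g ∈ homogeneousSubmodule (Fin n) k e := hij ▸ hpf.mul hg
      exact hgI ((hφ _ hpfg).mp (mul_assoc p f g ▸ h g hg))
    · intro h g hg
      have hpfg : p * f * g ∈ homogeneousSubmodule (Fin n) k e := hij ▸ hpf.mul hg
      rw [← mul_assoc]
      exact (hφ _ hpfg).mpr (I.mul_mem_right g h)
  -- By `key`, both kernels of the pairing (f, g) ↦ φ(pfg) are given by `I : p`.
  let B := ((LinearMap.mul k (MvPolynomial (Fin n) k)).compr₂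
    (φ ∘ₗ LinearMap.mulLeft k p)).domRestrict₁₂
    (homogeneousSubmodule (Fin n) k i) (homogeneousSubmodule (Fin n) k j)
  have hB : ∀ f g, B f g = φ (p * (f * g)) := fun _ _ => rfl
  rw [← finrank_quotient_eq_quotRank (N := LinearMap.ker B),
    ← finrank_quotient_eq_quotRank (N := LinearMap.ker B.flip), finrank_quotient_ker_flip]
  · intro g
    rw [Submodule.mem_comap, LinearMap.mulLeft_apply, Submodule.restrictScalars_mem,
      ← key (j := i) (by omega) g g.2, LinearMap.mem_ker, LinearMap.ext_iff, Subtype.forall]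
    simp only [LinearMap.flip_apply, hB, LinearMap.zero_apply,
      mul_comm (g : MvPolynomial (Fin n) k)]
  · intro f
    rw [Submodule.mem_comap, LinearMap.mulLeft_apply, Submodule.restrictScalars_mem,
      ← key hij f f.2, LinearMap.mem_ker, LinearMap.ext_iff, Subtype.forall]
    simp only [hB, LinearMap.zero_apply]

theorem hilbertFunction_symm (hG : IsArtinianGorenstein I) {e : ℕ}
    (he : IsGreatest {d | hilbertFunction I d ≠ 0} e) {i j : ℕ} (hij : i + j = e) :
    hilbertFunction I i = hilbertFunction I j := by
  have h := quotRank_comap_mulLeft_symm hG he (a := 0) (i := i) (j := j) (by omega)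
    (isHomogeneous_one _ _)
  rw [LinearMap.mulLeft_one, Submodule.comap_id] at h
  rwa [hilbertFunction_eq_quotRank, hilbertFunction_eq_quotRank]

/-- The first difference of the Hilbert function of a Gorenstein algebra is a difference of two
values of the Hilbert function of its quotient by a linear form. -/
theorem hilbertFunction_add_restrictionRank (hG : IsArtinianGorenstein I) {e : ℕ}
    (he : IsGreatest {d | hilbertFunction I d ≠ 0} e) {i j : ℕ} (hij : i + j + 1 = e)
    {L : MvPolynomial (Fin n) k} (hL : L ∈ homogeneousSubmodule (Fin n) k 1) :
    hilbertFunction I (i + 1) + restrictionRank (I.restrictScalars k) L (j + 1) =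
      hilbertFunction I i + restrictionRank (I.restrictScalars k) L (i + 1) := by
  rw [hilbertFunction_symm hG he (i := i) (j := j + 1) (by omega), hilbertFunction_eq_quotRank,
    hilbertFunction_eq_quotRank, quotRank_succ_eq_add _ hL i, quotRank_succ_eq_add _ hL j,
    quotRank_comap_mulLeft_symm hG he (i := i) (j := j) (by omega) hL]
  omega

end Duality

/-! ### Numerical comparison and conclusion. -/

theorem two_mul_staircase_add_ge (d s : ℕ) : 2 * s * d ≤ 2 * staircase d s + s * (s - 1) := by
  induction s with
  | zero => simp
  | succ s ih =>
    have h : staircase d (s + 1) = staircase d s + (d - s) := Finset.sum_range_succ _ _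
    have hs : s * (s - 1) + 2 * s = (s + 1) * s := by
      cases s with
      | zero => rfl
      | succ s => simp only [Nat.add_sub_cancel]; ring
    have h1 : d ≤ (d - s) + s := by omega
    rw [h, Nat.add_sub_cancel]
    linarith

theorem hilbertFunction_le_succ {k : Type*} [Field k] [Infinite k] {e i : ℕ}
    {I : Ideal (MvPolynomial (Fin 4) k)} (hG : IsArtinianGorenstein I)
    (he : IsGreatest {d | hilbertFunction I d ≠ 0} e) (hie : i ^ 2 + 12 * i + 2 < 6 * e) :
    hilbertFunction I i ≤ hilbertFunction I (i + 1) := by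
  have h2i : 2 * i + 1 ≤ e := by nlinarith [sq_nonneg i]
  obtain ⟨j, rfl⟩ : ∃ j, e = i + j + 1 := ⟨e - i - 1, by omega⟩
  have hij : i ≤ j := by omega
  obtain ⟨L, hL⟩ := exists_restrictionRank_minimal (I.restrictScalars k) (j + 1)
  have hdiff := hilbertFunction_add_restrictionRank hG he rfl L.2
  have hgreen := restrictionRank_add_staircase_le (j + 1) _ L hL
  rw [← hilbertFunction_eq_quotRank, ← hilbertFunction_symm hG he (add_assoc i j 1).symm] at hgreen
  suffices h : restrictionRank (I.restrictScalars k) (L : MvPolynomial (Fin 4) k) (j + 1) ≤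
      restrictionRank (I.restrictScalars k) (L : MvPolynomial (Fin 4) k) (i + 1) by omega
  by_contra! hlt
  have hbig : i + 1 <
      restrictionRank (I.restrictScalars k) (L : MvPolynomial (Fin 4) k) (i + 1) := by
    by_contra! hsmall
    refine absurd hlt (not_lt.mpr ?_)
    have hstep : ∀ m, i ≤ m →
        restrictionRank (I.restrictScalars k) (L : MvPolynomial (Fin 4) k) (m + 1) ≤
          restrictionRank (I.restrictScalars k) (L : MvPolynomial (Fin 4) k) (i + 1) := by
      intro m hm
      induction m, hm using Nat.le_induction with
      | base => exact le_rfl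
      | succ m hm ih =>
        refine le_trans (quotRank_succ_le_of_le (m := m + 1) (fun x hx f hf => ?_) ?_) ih
        · obtain ⟨a, ha, b, hb, rfl⟩ := Submodule.mem_sup.mp hf
          rw [mul_add]
          exact Submodule.add_mem_sup (I.mul_mem_left x ha) (mul_mem_formMultiples hx hb)
        · exact ih.trans (hsmall.trans (by omega))
    exact hstep j hij
  have hmono := staircase_mono (j + 1) (show i + 3 ≤ _ from by omega :
    i + 3 ≤ restrictionRank (I.restrictScalars k) (L : MvPolynomial (Fin 4) k) (j + 1))
  have hdim : hilbertFunction I i ≤ (i + 3).choose 3 := by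
    rw [hilbertFunction_eq_quotRank]
    refine (quotRank_le_finrank _ _).trans ?_
    rw [finrank_homogeneousSubmodule, show 4 + i - 1 = i + 3 by omega, Nat.choose_symm_add]
  have hstair := two_mul_staircase_add_ge (j + 1) (i + 3)
  have hchoose : 6 * (i + 3).choose 3 = (i + 3) * (i + 2) * (i + 1) := by
    have h := Nat.descFactorial_eq_factorial_mul_choose (i + 3) 3
    simp only [Nat.descFactorial, Nat.factorial] at h
    simp at h
    linarith
  rw [show i + 3 - 1 = i + 2 by omega] at hstair
  have hlow : (i + 3) + staircase (j + 1) (i + 3) ≤ (i + 3).choose 3 := by omega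
  have hlow6 : 6 * ((i + 3) + staircase (j + 1) (i + 3)) ≤ (i + 3) * (i + 2) * (i + 1) := by
    omega
  -- Cancelling `i + 3` leaves 6(i + j + 1) ≤ i² + 12i + 2, contrary to `hie`.
  have hcmp : (i + 3) * (6 + 6 * (j + 1)) ≤ (i + 3) * ((i + 2) * (i + 1) + 3 * (i + 2)) := by
    linarith
  have := Nat.le_of_mul_le_mul_left hcmp (by omega)
  nlinarith

theorem corollary2p8 {k : Type*} [Field k] [Infinite k] (e i : ℕ) (h : ℕ → ℕ)
    (hG : IsGorensteinHVector k 4 e h)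
    (he : ((i : ℝ) ^ 2 + 12 * (i : ℝ) + 2) / 6 < (e : ℝ)) :
    UnimodalUpTo h (i + 1) := by
  obtain ⟨I, hI, hh, -, hgreat⟩ := hG
  obtain rfl : h = hilbertFunction I := funext hh
  intro j hj
  refine hilbertFunction_le_succ hI hgreat ?_
  have hie : i ^ 2 + 12 * i + 2 < 6 * e := by
    rw [div_lt_iff₀ (by norm_num)] at he
    have : (i : ℝ) ^ 2 + 12 * i + 2 < 6 * e := by linarith
    exact_mod_cast this
  have hji : j ≤ i := Nat.lt_succ_iff.mp hj
  have := Nat.pow_le_pow_left hji 2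
  omega
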